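/- Let $d\in\mathbb N$ and $0<\alpha<d$. For measurable $f,g:\mathbb R^d\to\mathbb R$ put \[ J_\alpha(f,g)(x)=\int_0^1\int_{\mathbb R^d} f(x+(\theta-1)y)\,g(x+\theta y)\,|y|^{\alpha-d-2}\,y\otimes y\,dy\,d\theta , \qquad S_\alpha(\rho)=\tfrac12 J_\alpha(\rho,\rho), \] at every $x$ at which the double integral converges absolutely. The norm of a tensor is the operator norm of the corresponding linear map of $\mathbb R^d$ (where $(y\otimes y)v=(y\cdot v)y$), and $\|T\|_{L^r}$ is the $L^r(\mathbb R^d)$ norm of the norm of $T$. (1) Let $p,q,r$ be real numbers with \[ 1<p,q<\frac d\alpha,\qquad r\ge 1,\qquad \frac1p+\frac1q=\frac1r+\frac\alpha d . \] Then there is a constant $C=C(\alpha,d,p,q)>0$ such that for all $f\in L^p(\mathbb R^d)$ and $g\in L^q(\mathbb R^d)$ the integral $J_\alpha(f,g)(x)$ converges absolutely for almost every $x$, $J_\alpha(f,g)\in L^r(\mathbb R^d)$, and \[ \|J_\alpha(f,g)\|_{L^r(\mathbb R^d)}\le C\,\|f\|_{L^p(\mathbb R^d)}\,\|g\|_{L^q(\mathbb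 R^d)} . \] (2) Let $r\ge1$ be a real number such that $p:=\dfrac{2dr}{d+\alpha r}$ satisfies $1<p<\dfrac d\alpha$. Then there is a constant $C=C(\alpha,d,r)>0$ such that for all $\rho\in L^p(\mathbb R^d)$ the integral $S_\alpha(\rho)(x)$ converges absolutely for almost every $x$, $S_\alpha(\rho)\in L^r(\mathbb R^d)$, and \[ \|S_\alpha(\rho)\|_{L^r(\mathbb R^d)}\le C\,\|\rho\|_{L^p(\mathbb R^d)}^2 . \] In particular this holds, with the same $C$, for every $\rho\in L^1(\mathbb R^d)\cap L^\gamma(\mathbb R^d)$ with $\gamma\ge p$, since such $\rho$ belong to $L^p(\mathbb R^d)$. -/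

import Mathlib

open MeasureTheory

/-- The tensor `f (x + (θ - 1) y) g (x + θ y) |y|^(α - d - 2) y ⊗ y` as a function of `(θ, y)`.
A tensor on `ℝ^d` is a continuous linear endomorphism of Euclidean space, so that its norm is the
operator norm; `y ⊗ y` is the endomorphism `v ↦ ⟨y, v⟩ y`. -/
noncomputable def tensorIntegrand {d : ℕ} (α : ℝ) (f g : EuclideanSpace ℝ (Fin d) → ℝ)
    (x : EuclideanSpace ℝ (Fin d)) (z : ℝ × EuclideanSpace ℝ (Fin d)) :
    EuclideanSpace ℝ (Fin d) →L[ℝ] EuclideanSpace ℝ (Fin d) :=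
  (f (x + (z.1 - 1) • z.2) * g (x + z.1 • z.2) * ‖z.2‖ ^ (α - (d : ℝ) - 2)) •
    InnerProductSpace.rankOne ℝ z.2 z.2

/-- The bilinear tensor-valued operator
`J_α(f,g)(x) = ∫_0^1 ∫_{ℝ^d} f (x + (θ - 1) y) g (x + θ y) |y|^(α - d - 2) y ⊗ y dy dθ`. -/
noncomputable def tensorJ {d : ℕ} (α : ℝ) (f g : EuclideanSpace ℝ (Fin d) → ℝ)
    (x : EuclideanSpace ℝ (Fin d)) :
    EuclideanSpace ℝ (Fin d) →L[ℝ] EuclideanSpace ℝ (Fin d) :=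
  ∫ θ in (0 : ℝ)..1, ∫ y : EuclideanSpace ℝ (Fin d), tensorIntegrand α f g x (θ, y)

/-- The tensor
`S_α(ρ)(x) = 1/2 ∫_0^1 ∫_{ℝ^d} ρ (x + (θ - 1) y) ρ (x + θ y) |y|^(α - d - 2) y ⊗ y dy dθ`. -/
noncomputable def tensorS {d : ℕ} (α : ℝ) (ρ : EuclideanSpace ℝ (Fin d) → ℝ)
    (x : EuclideanSpace ℝ (Fin d)) :
    EuclideanSpace ℝ (Fin d) →L[ℝ] EuclideanSpace ℝ (Fin d) :=
  (1 / 2 : ℝ) •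
    ∫ θ in (0 : ℝ)..1, ∫ y : EuclideanSpace ℝ (Fin d), tensorIntegrand α ρ ρ x (θ, y)

/-- The double integral defining `J_α(f,g)(x)` converges absolutely. -/
def TensorConverges {d : ℕ} (α : ℝ) (f g : EuclideanSpace ℝ (Fin d) → ℝ)
    (x : EuclideanSpace ℝ (Fin d)) : Prop :=
  Integrable (tensorIntegrand α f g x)
    ((volume.restrict (Set.Ioc (0 : ℝ) 1)).prod (volume : Measure (EuclideanSpace ℝ (Fin d))))

/-!
# Bilinear tensor estimates of fractional integration type

The operator norm of `y ⊗ y` is `|y|²`, so the norm of `J_α(f,g)(x)` is at most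
`∫₀¹ ∫ |f (x + (θ - 1) y)| |g (x + θ y)| |y|^(α - n) dy dθ` (`segmentPotential`), and everything
follows from an `L^p × L^q → L^r` bound for this positive operator (`segmentPotential_Lp_le`).

The substitution `(θ, y) ↦ (1 - θ, -y)` exchanges `f` and `g`, so it suffices to treat `θ ≤ 1/2`. Put
`b = 1/q`, `c = 1 - 1/r`, `t₁ = b / (b + c)` and `t₂ = c / (b + c)`. Hölder's inequality in `(θ, y)`,
applied to `F G = (F G^(1/t₁))^t₁ F^t₂`, bounds the operator at `x` by `A(x)^t₁ (2^n I_α F(x))^t₂`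
(`segmentPotential_half_le`). Here `I_α F` is the Riesz potential: it arises from
`y ↦ F (x + (θ - 1) y)` because the dilation factor `1 - θ` is bounded below. The function `A` is the
same operator applied to `F` and `G^(1/t₁)`, and its integral over `x` is at most
`∫ G^(1/t₁) I_α F` (`lintegral_segmentPotential_half_le`), since for fixed `θ` the integral in `x` is
invariant under translation by `θ y`. A second use of Hölder's inequality, now in `x`, leaves only
the norm of `I_α F` in `L^s` with `1/s = 1 - (b + c) = 1/p - α/n`, which is positive exactly because
`p < n/α`. Exchanging `f` and `g` gives the requirement `q < n/α`. The argument does not distinguish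
`1/p + 1/q < 1` from `1/p + 1/q ≥ 1`, and `r = 1` is the case `t₂ = 0`.

The Hardy–Littlewood–Sobolev bound for `I_α` (`rieszPotential_Lp_le`) comes from Hedberg's pointwise
inequality `I_α F ≤ C (M F)^(1 - αp/n) ‖F‖_p^(αp/n)` (`rieszPotential_le_dyadicMaximal`) and the
maximal theorem (`lintegral_dyadicMaximal_rpow_le`). The latter is obtained from the Vitali covering
lemma and the layer cake formula.
-/

open Metric Module Set
open scoped ENNReal NNReal

/-! ### Power integrals and the layer cake formula -/

theorem lintegral_Ioc_zero_rpow {a c : ℝ} (ha : 0 < a) (hc : 0 < c) :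
    ∫⁻ t in Ioc 0 c, ENNReal.ofReal (t ^ (a - 1)) = ENNReal.ofReal (c ^ a / a) := by
  have hi : IntervalIntegrable (fun t : ℝ => t ^ (a - 1)) volume 0 c :=
    intervalIntegral.intervalIntegrable_rpow' (by linarith)
  rw [← ofReal_integral_eq_lintegral_ofReal, ← intervalIntegral.integral_of_le hc.le,
    integral_rpow (Or.inl (by linarith))]
  · simp [Real.zero_rpow ha.ne']
  · exact (intervalIntegrable_iff_integrableOn_Ioc_of_le hc.le).1 hi
  · filter_upwards [ae_restrict_mem measurableSet_Ioc] with t ht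
    exact Real.rpow_nonneg ht.1.le _

theorem lintegral_Ioi_rpow_neg {a c : ℝ} (ha : 0 < a) (hc : 0 < c) :
    ∫⁻ t in Ioi c, ENNReal.ofReal (t ^ (-a - 1)) = ENNReal.ofReal (c ^ (-a) / a) := by
  rw [← ofReal_integral_eq_lintegral_ofReal, integral_Ioi_rpow_of_lt (by linarith) hc]
  · congr 1
    rw [show -a - 1 + 1 = -a by ring, neg_div_neg_eq]
  · exact integrableOn_Ioi_rpow_of_lt (by linarith) hc
  · filter_upwards [ae_restrict_mem measurableSet_Ioi] with t ht
    exact Real.rpow_nonneg (hc.trans ht).le _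

theorem lintegral_Ioi_zero_rpow (a : ℝ) :
    ∫⁻ t in Ioi (0 : ℝ), ENNReal.ofReal (t ^ a) = ⊤ := by
  by_contra h
  refine not_integrableOn_Ioi_rpow a ⟨?_, ?_⟩
  · exact (measurable_id.pow_const a).aestronglyMeasurable
  · rw [hasFiniteIntegral_iff_norm]
    refine lt_of_le_of_lt (le_of_eq ?_) (lt_top_iff_ne_top.2 h)
    refine setLIntegral_congr_fun measurableSet_Ioi fun t ht => ?_
    simp only [Real.norm_eq_abs, abs_of_nonneg (Real.rpow_nonneg (le_of_lt ht) a)]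

/-- Sublevel form of the power integral, valid for every extended nonnegative `m`. -/
theorem lintegral_ite_lt_rpow {a : ℝ} (ha : 0 < a) (m : ℝ≥0∞) :
    ∫⁻ t in Ioi (0 : ℝ), (if ENNReal.ofReal t < m then ENNReal.ofReal (t ^ (a - 1)) else 0) =
      ENNReal.ofReal a⁻¹ * m ^ a := by
  rcases eq_or_ne m ⊤ with rfl | hm
  · simp only [ENNReal.ofReal_lt_top, if_true, lintegral_Ioi_zero_rpow, ENNReal.top_rpow_of_pos ha]
    rw [ENNReal.mul_top]
    simpa using ha
  lift m to ℝ≥0 using hm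
  rcases eq_or_ne m 0 with rfl | hm
  · simp [ENNReal.zero_rpow_of_pos ha]
  have hm' : (0 : ℝ) < m := by positivity
  have h1 : ∀ t ∈ Ioi (0 : ℝ), (if ENNReal.ofReal t < (m : ℝ≥0∞) then
      ENNReal.ofReal (t ^ (a - 1)) else 0) =
      (Iio (m : ℝ)).indicator (fun t => ENNReal.ofReal (t ^ (a - 1))) t := by
    intro t ht
    have : ENNReal.ofReal t < (m : ℝ≥0∞) ↔ t < m := by
      rw [← ENNReal.ofReal_coe_nnreal, ENNReal.ofReal_lt_ofReal_iff hm']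
    simp only [this, indicator, mem_Iio]
  rw [setLIntegral_congr_fun measurableSet_Ioi h1, setLIntegral_indicator measurableSet_Iio,
    Iio_inter_Ioi, setLIntegral_congr Ioo_ae_eq_Ioc, lintegral_Ioc_zero_rpow ha hm',
    ← ENNReal.ofReal_coe_nnreal, ENNReal.ofReal_rpow_of_pos hm', ← ENNReal.ofReal_mul (by positivity)]
  congr 1
  field_simp

/-- Superlevel form of the power integral, valid for every extended nonnegative `m`. -/
theorem lintegral_ite_gt_rpow {a : ℝ} (ha : 0 < a) (m : ℝ≥0∞) :
    ∫⁻ t in Ioi (0 : ℝ), (if m < ENNReal.ofReal t then ENNReal.ofReal (t ^ (-a - 1)) else 0) =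
      ENNReal.ofReal a⁻¹ * m ^ (-a) := by
  rcases eq_or_ne m ⊤ with rfl | hm
  · simp [ENNReal.top_rpow_of_neg (neg_lt_zero.2 ha)]
  lift m to ℝ≥0 using hm
  rcases eq_or_ne m 0 with rfl | hm
  · rw [ENNReal.coe_zero, ENNReal.zero_rpow_of_neg (neg_lt_zero.2 ha), ENNReal.mul_top (by simpa),
      ← lintegral_Ioi_zero_rpow (-a - 1)]
    refine setLIntegral_congr_fun measurableSet_Ioi fun t ht => ?_
    simp only [mem_Ioi] at ht
    simp [ht]
  have hm' : (0 : ℝ) < m := by positivity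
  have h1 : ∀ t ∈ Ioi (0 : ℝ), (if (m : ℝ≥0∞) < ENNReal.ofReal t then
      ENNReal.ofReal (t ^ (-a - 1)) else 0) =
      (Ioi (m : ℝ)).indicator (fun t => ENNReal.ofReal (t ^ (-a - 1))) t := by
    intro t ht
    have : (m : ℝ≥0∞) < ENNReal.ofReal t ↔ m < t := by
      rw [← ENNReal.ofReal_coe_nnreal, ENNReal.ofReal_lt_ofReal_iff ht]
    simp only [this, indicator, mem_Ioi]
  rw [setLIntegral_congr_fun measurableSet_Ioi h1, setLIntegral_indicator measurableSet_Ioi,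
    Ioi_inter_Ioi, sup_eq_left.2 hm'.le, lintegral_Ioi_rpow_neg ha hm',
    ← ENNReal.ofReal_coe_nnreal, ENNReal.ofReal_rpow_of_pos hm', ← ENNReal.ofReal_mul (by positivity)]
  congr 1
  field_simp

/-- The layer cake formula for extended nonnegative functions. -/
theorem lintegral_rpow_eq_lintegral_meas {X : Type*} [MeasurableSpace X]
    {μ : Measure X} [SFinite μ] {h : X → ℝ≥0∞} (hh : Measurable h) {a : ℝ} (ha : 0 < a) :
    ∫⁻ x, h x ^ a ∂μ = ENNReal.ofReal a *
      ∫⁻ t in Ioi (0 : ℝ), ENNReal.ofReal (t ^ (a - 1)) * μ {x | ENNReal.ofReal t < h x} := by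
  have hms : MeasurableSet {z : ℝ × X | ENNReal.ofReal z.1 < h z.2} :=
    measurableSet_lt (by fun_prop) (by fun_prop)
  have hsw := lintegral_lintegral_swap (μ := volume.restrict (Ioi (0 : ℝ))) (ν := μ)
    (f := fun t x => if ENNReal.ofReal t < h x then ENNReal.ofReal (t ^ (a - 1)) else 0)
    (Measurable.ite hms (by fun_prop) measurable_const).aemeasurable
  have h2 : ∀ t : ℝ, ∫⁻ x, (if ENNReal.ofReal t < h x then ENNReal.ofReal (t ^ (a - 1)) else 0) ∂μ
      = ENNReal.ofReal (t ^ (a - 1)) * μ {x | ENNReal.ofReal t < h x} := by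
    intro t
    rw [← lintegral_indicator_const (measurableSet_lt measurable_const hh)]
    simp only [indicator, mem_ofPred_eq]
  simp only [h2, lintegral_ite_lt_rpow ha] at hsw
  rw [hsw, lintegral_const_mul _ (by fun_prop), ← mul_assoc, ← ENNReal.ofReal_mul ha.le,
    mul_inv_cancel₀ ha.ne', ENNReal.ofReal_one, one_mul]

/-! ### The maximal function -/

section Haar

variable {E : Type*} [NormedAddCommGroup E] [NormedSpace ℝ E] [FiniteDimensional ℝ E]
  [MeasurableSpace E] [BorelSpace E]

/-- The centred maximal function over balls of dyadic radius. The countable family of radii makes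
measurability immediate and costs only a factor `2 ^ dim` against the full maximal function. -/
noncomputable def dyadicMaximal (μ : Measure E) (F : E → ℝ≥0∞) (x : E) : ℝ≥0∞ :=
  ⨆ k : ℤ, (∫⁻ y in ball x ((2 : ℝ) ^ k), F y ∂μ) / μ (ball 0 ((2 : ℝ) ^ k))

theorem measurable_setLIntegral_ball {μ : Measure E} [SFinite μ] {F : E → ℝ≥0∞}
    (hF : Measurable F) (s : ℝ) : Measurable fun x => ∫⁻ y in ball x s, F y ∂μ := by
  have h : ∀ x, ∫⁻ y in ball x s, F y ∂μ =
      ∫⁻ y, {z : E × E | dist z.2 z.1 < s}.indicator (fun z => F z.2) (x, y) ∂μ := by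
    intro x
    rw [← lintegral_indicator measurableSet_ball]
    rfl
  simp only [h]
  refine Measurable.lintegral_prod_right' (ν := μ) ?_
  exact (hF.comp measurable_snd).indicator (measurableSet_lt (by fun_prop) measurable_const)

theorem measurable_dyadicMaximal {μ : Measure E} [SFinite μ] {F : E → ℝ≥0∞}
    (hF : Measurable F) : Measurable (dyadicMaximal μ F) :=
  Measurable.iSup fun _ => (measurable_setLIntegral_ball hF _).div_const _

variable (μ : Measure E) [μ.IsAddHaarMeasure]

/-- The weak type `(1,1)` inequality, from the Vitali covering lemma. -/
theorem mul_meas_lt_dyadicMaximal_le [Nontrivial E] (F : E → ℝ≥0∞) {l : ℝ≥0∞} (hl : l ≠ 0)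
    (hl' : l ≠ ⊤) :
    l * μ {x | l < dyadicMaximal μ F x} ≤ 5 ^ finrank ℝ E * ∫⁻ x, F x ∂μ := by
  have hn : finrank ℝ E ≠ 0 := (finrank_pos (R := ℝ) (M := E)).ne'
  rcases eq_or_ne (∫⁻ x, F x ∂μ) ⊤ with hI | hI
  · rw [hI, ENNReal.mul_top (by positivity)]
    exact le_top
  set V := μ (ball (0 : E) 1) with hV
  have hV0 : V ≠ 0 := (measure_ball_pos μ 0 one_pos).ne'
  have hV1 : V ≠ ⊤ := measure_ball_lt_top.ne
  have hball : ∀ (x : E) (s : ℝ), 0 ≤ s → μ (closedBall x s) = ENNReal.ofReal (s ^ finrank ℝ E) * V :=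
    fun x s hs => Measure.addHaar_closedBall μ x hs
  have key : ∀ x ∈ {x | l < dyadicMaximal μ F x}, ∃ k : ℤ,
      l * μ (closedBall x ((2 : ℝ) ^ k)) ≤ ∫⁻ y in closedBall x ((2 : ℝ) ^ k), F y ∂μ := by
    intro x hx
    rw [mem_ofPred_eq, dyadicMaximal, lt_iSup_iff] at hx
    obtain ⟨k, hk⟩ := hx
    have hp : (0 : ℝ) < 2 ^ k := by positivity
    refine ⟨k, ?_⟩
    rw [ENNReal.lt_div_iff_mul_lt (Or.inl (measure_ball_pos μ 0 hp).ne')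
      (Or.inl measure_ball_lt_top.ne)] at hk
    rw [Measure.addHaar_closedBall_eq_addHaar_ball, Measure.addHaar_ball_center]
    exact hk.le.trans (lintegral_mono_set ball_subset_closedBall)
  choose! k hk using key
  set T := {x | l < dyadicMaximal μ F x}
  -- finiteness of the integral of `F` bounds the radii, as the covering lemma requires
  obtain ⟨R, hR⟩ : ∃ R : ℝ, ∀ x ∈ T, (2 : ℝ) ^ k x ≤ R := by
    set B := (∫⁻ x, F x ∂μ) / (l * V) with hB
    have hBt : B ≠ ⊤ := ENNReal.div_ne_top hI (mul_ne_zero hl hV0)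
    refine ⟨max 1 B.toReal, fun x hx => ?_⟩
    by_contra! hlt
    obtain ⟨h1, h2⟩ := max_lt_iff.1 hlt
    have h3 : ENNReal.ofReal (((2 : ℝ) ^ k x) ^ finrank ℝ E) ≤ B := by
      rw [hB, ENNReal.le_div_iff_mul_le (Or.inl (mul_ne_zero hl hV0))
        (Or.inl (ENNReal.mul_ne_top hl' hV1))]
      calc _ = l * μ (closedBall x ((2 : ℝ) ^ k x)) := by rw [hball x _ (by positivity)]; ring
        _ ≤ _ := (hk x hx).trans (setLIntegral_le_lintegral _ _)
    have h4 := (ENNReal.ofReal_le_iff_le_toReal hBt).1 h3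
    have h5 : (2 : ℝ) ^ k x ≤ ((2 : ℝ) ^ k x) ^ finrank ℝ E := le_self_pow₀ h1.le hn
    linarith
  obtain ⟨u, huT, hdisj, hcov⟩ := Vitali.exists_disjoint_subfamily_covering_enlargement_closedBall
    T (fun x => x) (fun x => (2 : ℝ) ^ k x) R hR 5 (by norm_num)
  have hucount : u.Countable := hdisj.countable_of_nonempty_interior fun x _ =>
    (nonempty_ball.2 (by positivity : (0 : ℝ) < 2 ^ k x)).mono ball_subset_interior_closedBall
  have hsub : T ⊆ ⋃ x ∈ u, closedBall x (5 * (2 : ℝ) ^ k x) := by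
    intro x hx
    obtain ⟨y, hy, hxy⟩ := hcov x hx
    exact mem_biUnion hy (hxy (mem_closedBall_self (by positivity)))
  have : Countable u := hucount.to_subtype
  calc l * μ T ≤ l * ∑' x : u, μ (closedBall (x : E) (5 * (2 : ℝ) ^ k x)) := by
        gcongr
        exact (measure_mono hsub).trans (measure_biUnion_le μ hucount _)
    _ = 5 ^ finrank ℝ E * ∑' x : u, l * μ (closedBall (x : E) ((2 : ℝ) ^ k x)) := by
        rw [← ENNReal.tsum_mul_left, ← ENNReal.tsum_mul_left]
        refine tsum_congr fun x => ?_
        rw [hball _ _ (by positivity), hball _ _ (by positivity), mul_pow,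
          ENNReal.ofReal_mul (by positivity), ENNReal.ofReal_pow (by norm_num)]
        norm_num
        ring
    _ ≤ 5 ^ finrank ℝ E * ∑' x : u, ∫⁻ y in closedBall (x : E) ((2 : ℝ) ^ k x), F y ∂μ := by
        gcongr with x
        exact hk x (huT x.2)
    _ = 5 ^ finrank ℝ E * ∫⁻ y in ⋃ x ∈ u, closedBall (x : E) ((2 : ℝ) ^ k x), F y ∂μ := by
        rw [lintegral_biUnion hucount (fun _ _ => measurableSet_closedBall) hdisj]
    _ ≤ _ := mul_le_mul_right (setLIntegral_le_lintegral _ _) _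

/-- Splitting `F` at half the height: only the large values of `F` matter for the superlevel sets
of its maximal function. -/
theorem mul_meas_lt_dyadicMaximal_le_half [Nontrivial E] (F : E → ℝ≥0∞) {t : ℝ} (ht : 0 < t) :
    ENNReal.ofReal t * μ {x | ENNReal.ofReal t < dyadicMaximal μ F x} ≤
      2 * 5 ^ finrank ℝ E * ∫⁻ x, (if ENNReal.ofReal t < 2 * F x then F x else 0) ∂μ := by
  set l := ENNReal.ofReal (t / 2) with hl
  have hl0 : l ≠ 0 := by simpa [hl] using ht
  have htl : ENNReal.ofReal t = 2 * l := by
    rw [hl, ← ENNReal.ofReal_ofNat, ← ENNReal.ofReal_mul (by norm_num)]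
    congr 1; ring
  set G : E → ℝ≥0∞ := fun x => if ENNReal.ofReal t < 2 * F x then F x else 0 with hG
  have hle : ∀ x, F x ≤ G x + l := by
    intro x
    by_cases h : ENNReal.ofReal t < 2 * F x
    · simp [hG, h]
    · simp only [hG, h, if_false, zero_add]
      rw [htl, not_lt] at h
      exact (ENNReal.mul_le_mul_iff_right (by norm_num) (by norm_num)).1 h
  have hM : ∀ x, dyadicMaximal μ F x ≤ dyadicMaximal μ G x + l := by
    intro x
    refine iSup_le fun k => ?_
    have hp : (0 : ℝ) < 2 ^ k := by positivity
    have hb0 := (measure_ball_pos μ (0 : E) hp).ne'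
    have hb1 : μ (ball (0 : E) (2 ^ k)) ≠ ⊤ := measure_ball_lt_top.ne
    calc (∫⁻ y in ball x ((2 : ℝ) ^ k), F y ∂μ) / μ (ball 0 ((2 : ℝ) ^ k))
        ≤ (∫⁻ y in ball x ((2 : ℝ) ^ k), (G y + l) ∂μ) / μ (ball 0 ((2 : ℝ) ^ k)) := by
          gcongr with y
          exact hle y
      _ = (∫⁻ y in ball x ((2 : ℝ) ^ k), G y ∂μ) / μ (ball 0 ((2 : ℝ) ^ k)) + l := by
          rw [lintegral_add_right _ measurable_const, setLIntegral_const,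
            Measure.addHaar_ball_center, ENNReal.add_div, ENNReal.mul_div_cancel_right hb0 hb1]
      _ ≤ _ := by
          gcongr
          exact le_iSup (fun k : ℤ => (∫⁻ y in ball x ((2 : ℝ) ^ k), G y ∂μ) /
            μ (ball 0 ((2 : ℝ) ^ k))) k
  have hsub : {x | ENNReal.ofReal t < dyadicMaximal μ F x} ⊆ {x | l < dyadicMaximal μ G x} := by
    intro x hx
    have h := lt_of_lt_of_le hx (hM x)
    rw [htl, two_mul] at h
    exact lt_of_add_lt_add_right h
  calc _ ≤ 2 * (l * μ {x | l < dyadicMaximal μ G x}) := by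
        rw [htl, mul_assoc, ← htl]
        gcongr
    _ ≤ 2 * (5 ^ finrank ℝ E * ∫⁻ x, G x ∂μ) :=
        mul_le_mul_right (mul_meas_lt_dyadicMaximal_le μ G hl0 ENNReal.ofReal_ne_top) _
    _ = _ := by ring

/-- The maximal theorem in `L^p`, `p > 1`. -/
theorem lintegral_dyadicMaximal_rpow_le [Nontrivial E] {p : ℝ} (hp : 1 < p) :
    ∃ C : ℝ≥0∞, C ≠ ⊤ ∧ ∀ F : E → ℝ≥0∞, Measurable F →
      ∫⁻ x, dyadicMaximal μ F x ^ p ∂μ ≤ C * ∫⁻ x, F x ^ p ∂μ := by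
  have hp1 : 0 < p - 1 := by linarith
  refine ⟨ENNReal.ofReal p * (2 * 5 ^ finrank ℝ E * (ENNReal.ofReal (p - 1)⁻¹ * 2 ^ (p - 1))), ?_, ?_⟩
  · refine ENNReal.mul_ne_top ENNReal.ofReal_ne_top (ENNReal.mul_ne_top ?_ (ENNReal.mul_ne_top
      ENNReal.ofReal_ne_top ?_))
    · exact ENNReal.mul_ne_top (by norm_num) (ENNReal.pow_ne_top (by norm_num))
    · exact ENNReal.rpow_ne_top_of_nonneg hp1.le (by norm_num)
  intro F hF
  have hms : MeasurableSet {z : ℝ × E | ENNReal.ofReal z.1 < 2 * F z.2} :=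
    measurableSet_lt (by fun_prop) (by fun_prop)
  rw [lintegral_rpow_eq_lintegral_meas (measurable_dyadicMaximal hF) (by linarith), mul_assoc]
  gcongr
  calc ∫⁻ t in Ioi (0 : ℝ), ENNReal.ofReal (t ^ (p - 1)) *
        μ {x | ENNReal.ofReal t < dyadicMaximal μ F x}
      ≤ ∫⁻ t in Ioi (0 : ℝ), 2 * 5 ^ finrank ℝ E * ∫⁻ x, (if ENNReal.ofReal t < 2 * F x then
          ENNReal.ofReal (t ^ (p - 1 - 1)) * F x else 0) ∂μ := by
        refine setLIntegral_mono' measurableSet_Ioi fun t ht => ?_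
        have ht' : (0 : ℝ) < t := ht
        have h1 : ENNReal.ofReal (t ^ (p - 1)) =
            ENNReal.ofReal (t ^ (p - 1 - 1)) * ENNReal.ofReal t := by
          rw [← ENNReal.ofReal_mul (by positivity), ← Real.rpow_add_one ht'.ne']
          congr 2; ring
        rw [h1, mul_assoc]
        refine (mul_le_mul_right (mul_meas_lt_dyadicMaximal_le_half μ F ht') _).trans (le_of_eq ?_)
        rw [mul_left_comm, ← lintegral_const_mul' _ _ ENNReal.ofReal_ne_top]
        simp only [mul_ite, mul_zero]
    _ = 2 * 5 ^ finrank ℝ E * ∫⁻ t in Ioi (0 : ℝ), ∫⁻ x, (if ENNReal.ofReal t < 2 * F x then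
          ENNReal.ofReal (t ^ (p - 1 - 1)) * F x else 0) ∂μ :=
        lintegral_const_mul' _ _ (ENNReal.mul_ne_top (by norm_num) (ENNReal.pow_ne_top (by norm_num)))
    _ = 2 * 5 ^ finrank ℝ E * ∫⁻ x, (∫⁻ t in Ioi (0 : ℝ), (if ENNReal.ofReal t < 2 * F x then
          ENNReal.ofReal (t ^ (p - 1 - 1)) * F x else 0)) ∂μ := by
        rw [lintegral_lintegral_swap]
        exact (Measurable.ite hms (by fun_prop) measurable_const).aemeasurable
    _ = 2 * 5 ^ finrank ℝ E * ∫⁻ x, (ENNReal.ofReal (p - 1)⁻¹ * 2 ^ (p - 1)) * F x ^ p ∂μ := by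
        congr 1
        refine lintegral_congr fun x => ?_
        have h2 : ∀ t : ℝ, (if ENNReal.ofReal t < 2 * F x then
            ENNReal.ofReal (t ^ (p - 1 - 1)) * F x else 0) = (if ENNReal.ofReal t < 2 * F x then
            ENNReal.ofReal (t ^ (p - 1 - 1)) else 0) * F x := by
          intro t
          rw [ite_mul, zero_mul]
        simp only [h2]
        rw [lintegral_mul_const _ (Measurable.ite (measurableSet_lt (by fun_prop) measurable_const)
          (by fun_prop) measurable_const), lintegral_ite_lt_rpow hp1,
          ENNReal.mul_rpow_of_nonneg _ _ hp1.le, mul_assoc, mul_assoc, mul_assoc]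
        congr 2
        nth_rewrite 2 [← ENNReal.rpow_one (F x)]
        rw [← ENNReal.rpow_add_of_nonneg _ _ hp1.le zero_le_one, sub_add_cancel]
    _ = _ := by
        rw [lintegral_const_mul _ (by fun_prop), ← mul_assoc]

/-! ### Riesz potentials -/

/-- The Riesz potential `∫ F (x - y) |y| ^ (α - n) dy` of a nonnegative function, without the
customary normalizing constant. -/
noncomputable def rieszPotential (α : ℝ) (F : E → ℝ≥0∞) (x : E) : ℝ≥0∞ :=
  ∫⁻ y, F (x - y) * ‖y‖ₑ ^ (α - finrank ℝ E) ∂μ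

theorem measurable_rieszPotential (α : ℝ) {F : E → ℝ≥0∞} (hF : Measurable F) :
    Measurable (rieszPotential μ α F) := by
  unfold rieszPotential
  exact Measurable.lintegral_prod_right' (f := fun z : E × E =>
    F (z.1 - z.2) * ‖z.2‖ₑ ^ (α - finrank ℝ E)) (by fun_prop)

/-- Writing the kernel as an integral over radii expresses the Riesz potential through the integrals
of `F` over balls. -/
theorem rieszPotential_eq_lintegral_ball {α : ℝ} (hαn : α < finrank ℝ E) {F : E → ℝ≥0∞}
    (hF : Measurable F) (x : E) :
    rieszPotential μ α F x = ENNReal.ofReal (finrank ℝ E - α) *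
      ∫⁻ t in Ioi (0 : ℝ), ENNReal.ofReal (t ^ (α - finrank ℝ E - 1)) *
        ∫⁻ y in ball x t, F y ∂μ := by
  have hn : 0 < (finrank ℝ E : ℝ) - α := by linarith
  set n : ℝ := (finrank ℝ E : ℝ) with hn_def
  have hker : ∀ y : E, ‖y‖ₑ ^ (α - n) = ENNReal.ofReal (n - α) * ∫⁻ t in Ioi (0 : ℝ),
      (if ‖y‖ₑ < ENNReal.ofReal t then ENNReal.ofReal (t ^ (α - n - 1)) else 0) := by
    intro y
    have := lintegral_ite_gt_rpow hn ‖y‖ₑ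
    rw [neg_sub] at this
    rw [this, ← mul_assoc, ← ENNReal.ofReal_mul hn.le, mul_inv_cancel₀ hn.ne', ENNReal.ofReal_one,
      one_mul]
  have hms : MeasurableSet {z : ℝ × E | ‖z.2‖ₑ < ENNReal.ofReal z.1} :=
    measurableSet_lt (by fun_prop) (by fun_prop)
  have hmeas : Measurable fun z : ℝ × E =>
      F (x - z.2) * (if ‖z.2‖ₑ < ENNReal.ofReal z.1 then ENNReal.ofReal (z.1 ^ (α - n - 1)) else 0) :=
    (by fun_prop : Measurable fun z : ℝ × E => F (x - z.2)).mul
      (Measurable.ite hms (by fun_prop) measurable_const)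
  calc rieszPotential μ α F x
      = ∫⁻ y, ENNReal.ofReal (n - α) * (∫⁻ t in Ioi (0 : ℝ), F (x - y) *
        (if ‖y‖ₑ < ENNReal.ofReal t then ENNReal.ofReal (t ^ (α - n - 1)) else 0)) ∂μ := by
        refine lintegral_congr fun y => ?_
        rw [hker, mul_left_comm, lintegral_const_mul]
        exact Measurable.ite (measurableSet_lt measurable_const (by fun_prop)) (by fun_prop)
          measurable_const
    _ = ENNReal.ofReal (n - α) * ∫⁻ t in Ioi (0 : ℝ), ∫⁻ y, F (x - y) *
        (if ‖y‖ₑ < ENNReal.ofReal t then ENNReal.ofReal (t ^ (α - n - 1)) else 0) ∂μ := by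
        rw [lintegral_const_mul' _ _ ENNReal.ofReal_ne_top]
        congr 1
        exact (lintegral_lintegral_swap (μ := volume.restrict (Ioi (0 : ℝ))) (ν := μ)
          (f := fun t y => F (x - y) *
            (if ‖y‖ₑ < ENNReal.ofReal t then ENNReal.ofReal (t ^ (α - n - 1)) else 0))
          hmeas.aemeasurable).symm
    _ = _ := by
        congr 1
        refine setLIntegral_congr_fun measurableSet_Ioi fun t ht => ?_
        have h1 := lintegral_sub_left_eq_self (μ := μ)
          (fun z => F z * (if ‖x - z‖ₑ < ENNReal.ofReal t then
            ENNReal.ofReal (t ^ (α - n - 1)) else 0)) x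
        simp only [sub_sub_cancel] at h1
        rw [h1, ← lintegral_const_mul' _ _ ENNReal.ofReal_ne_top,
          ← lintegral_indicator measurableSet_ball]
        refine lintegral_congr fun z => ?_
        have h2 : ‖x - z‖ₑ < ENNReal.ofReal t ↔ z ∈ ball x t := by
          rw [← ofReal_norm, ENNReal.ofReal_lt_ofReal_iff ht, mem_ball, dist_comm, dist_eq_norm]
        by_cases h : z ∈ ball x t
        · simp [h2, h, mul_comm]
        · simp [h2, h]

omit [BorelSpace E] in
/-- The factor `2` in the radius accounts for the passage to the next dyadic radius. -/
theorem setLIntegral_ball_le_dyadicMaximal (F : E → ℝ≥0∞) (x : E) {t : ℝ} (ht : 0 < t) :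
    ∫⁻ y in ball x t, F y ∂μ ≤ dyadicMaximal μ F x * μ (ball 0 (2 * t)) := by
  obtain ⟨k, hk1, hk2⟩ := exists_mem_Ioc_zpow ht (one_lt_two (α := ℝ))
  have hp : (0 : ℝ) < 2 ^ (k + 1) := by positivity
  calc ∫⁻ y in ball x t, F y ∂μ ≤ ∫⁻ y in ball x ((2 : ℝ) ^ (k + 1)), F y ∂μ :=
        lintegral_mono_set (ball_subset_ball hk2)
    _ = (∫⁻ y in ball x ((2 : ℝ) ^ (k + 1)), F y ∂μ) / μ (ball 0 ((2 : ℝ) ^ (k + 1))) *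
          μ (ball 0 ((2 : ℝ) ^ (k + 1))) :=
        (ENNReal.div_mul_cancel (measure_ball_pos μ 0 hp).ne' measure_ball_lt_top.ne).symm
    _ ≤ dyadicMaximal μ F x * μ (ball 0 (2 * t)) := by
        gcongr
        · exact le_iSup (fun k : ℤ => (∫⁻ y in ball x ((2 : ℝ) ^ k), F y ∂μ) /
            μ (ball 0 ((2 : ℝ) ^ k))) (k + 1)
        · rw [zpow_add_one₀ two_ne_zero, mul_comm]
          linarith

theorem setLIntegral_le_rpow_mul_meas_rpow {X : Type*} [MeasurableSpace X] (ν : Measure X)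
    {F : X → ℝ≥0∞} (hF : Measurable F) {p : ℝ} (hp : 1 ≤ p) (s : Set X) :
    ∫⁻ y in s, F y ∂ν ≤ (∫⁻ y, F y ^ p ∂ν) ^ (1 / p) * ν s ^ (1 - 1 / p) := by
  have hp0 : 0 < p := by linarith
  have h := ENNReal.lintegral_mul_norm_pow_le (μ := ν.restrict s) (f := fun y => F y ^ p)
    (g := fun _ => 1) (by fun_prop) (by fun_prop) (p := 1 / p) (q := 1 - 1 / p) (by positivity)
    (sub_nonneg.2 ((div_le_one hp0).2 hp)) (by ring)
  simp only [ENNReal.one_rpow, mul_one, ← ENNReal.rpow_mul, mul_one_div_cancel hp0.ne',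
    ENNReal.rpow_one, lintegral_const, one_mul, Measure.restrict_apply_univ] at h
  exact h.trans (mul_le_mul_left (ENNReal.rpow_le_rpow (setLIntegral_le_lintegral _ _)
    (by positivity)) _)

/-- The optimization behind Hedberg's inequality: split the integral at the radius where the two
bounds of the minimum agree. -/
theorem lintegral_min_rpow_le {a b : ℝ} (ha : 0 < a) (hb : 0 < b) {A B : ℝ} (hA : 0 < A)
    (hB : 0 < B) {Φ : ℝ → ℝ≥0∞}
    (h1 : ∀ t > 0, Φ t ≤ ENNReal.ofReal (A * t ^ (a - 1)))
    (h2 : ∀ t > 0, Φ t ≤ ENNReal.ofReal (B * t ^ (-b - 1))) :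
    ∫⁻ t in Ioi (0 : ℝ), Φ t ≤
      ENNReal.ofReal ((a⁻¹ + b⁻¹) * (A ^ (b / (a + b)) * B ^ (a / (a + b)))) := by
  set s : ℝ := (B / A) ^ (1 / (a + b)) with hs
  have hs0 : 0 < s := by positivity
  have hab : a + b ≠ 0 := by positivity
  have e1 : A * s ^ a = A ^ (b / (a + b)) * B ^ (a / (a + b)) := by
    rw [hs, ← Real.rpow_mul (by positivity), Real.div_rpow hB.le hA.le,
      show b / (a + b) = 1 - a / (a + b) by field_simp; ring, Real.rpow_sub hA, Real.rpow_one,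
      one_div_mul_eq_div]
    ring
  have e2 : B * s ^ (-b) = A ^ (b / (a + b)) * B ^ (a / (a + b)) := by
    rw [hs, ← Real.rpow_mul (by positivity), Real.div_rpow hB.le hA.le,
      show a / (a + b) = 1 - b / (a + b) by field_simp; ring, Real.rpow_sub hB, Real.rpow_one,
      one_div_mul_eq_div, neg_div, Real.rpow_neg hB.le, Real.rpow_neg hA.le]
    field_simp
  rw [← Ioc_union_Ioi_eq_Ioi hs0.le]
  refine (lintegral_union_le _ _ _).trans ?_
  calc _ ≤ (∫⁻ t in Ioc 0 s, ENNReal.ofReal (A * t ^ (a - 1))) +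
        ∫⁻ t in Ioi s, ENNReal.ofReal (B * t ^ (-b - 1)) :=
        add_le_add (setLIntegral_mono' measurableSet_Ioc fun t ht => h1 t ht.1)
          (setLIntegral_mono' measurableSet_Ioi fun t ht => h2 t (hs0.trans ht))
    _ = _ := by
        simp only [ENNReal.ofReal_mul hA.le, ENNReal.ofReal_mul hB.le]
        rw [lintegral_const_mul' _ _ ENNReal.ofReal_ne_top,
          lintegral_const_mul' _ _ ENNReal.ofReal_ne_top, lintegral_Ioc_zero_rpow ha hs0,
          lintegral_Ioi_rpow_neg hb hs0, ← ENNReal.ofReal_mul hA.le, ← ENNReal.ofReal_mul hB.le,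
          ← ENNReal.ofReal_add (by positivity) (by positivity), ← mul_div_assoc, ← mul_div_assoc,
          e1, e2]
        congr 1
        ring

/-- Hedberg's pointwise inequality. -/
theorem rieszPotential_le_dyadicMaximal {α p : ℝ} (hα : 0 < α) (hαn : α < finrank ℝ E)
    (hp : 1 < p) (hpα : p < finrank ℝ E / α) :
    ∃ C : ℝ≥0∞, C ≠ ⊤ ∧ ∀ F : E → ℝ≥0∞, Measurable F → ∫⁻ y, F y ^ p ∂μ ≠ ⊤ → ∀ x,
      rieszPotential μ α F x ≤ C * (dyadicMaximal μ F x ^ (1 - α * p / finrank ℝ E) *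
        ((∫⁻ y, F y ^ p ∂μ) ^ (1 / p)) ^ (α * p / finrank ℝ E)) := by
  have hN : (0 : ℝ) < finrank ℝ E := hα.trans hαn
  have : Nontrivial E := finrank_pos_iff.1 (by exact_mod_cast hN)
  have hp0 : 0 < p := by linarith
  have hn : 0 < (finrank ℝ E : ℝ) - α := by linarith
  have hαp : α * p < finrank ℝ E := by rwa [lt_div_iff₀ hα, mul_comm] at hpα
  have hb : 0 < finrank ℝ E / p - α := by
    rw [sub_pos, lt_div_iff₀ hp0]; exact hαp
  set n : ℝ := (finrank ℝ E : ℝ) with hn_def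
  set V := μ (ball (0 : E) 1) with hV
  have hV0 : V ≠ 0 := (measure_ball_pos μ 0 one_pos).ne'
  have hV1 : V ≠ ⊤ := measure_ball_lt_top.ne
  set v := V.toReal with hv
  have hv0 : 0 < v := ENNReal.toReal_pos hV0 hV1
  have hVv : V = ENNReal.ofReal v := (ENNReal.ofReal_toReal hV1).symm
  have hball : ∀ s : ℝ, 0 < s → ∀ x : E, μ (ball x s) = ENNReal.ofReal (s ^ n * v) := by
    intro s hs x
    rw [Measure.addHaar_ball μ x hs.le, ENNReal.ofReal_mul (by positivity), ← hVv, hn_def,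
      Real.rpow_natCast]
  set c1 : ℝ := 2 ^ n * v
  set c2 : ℝ := v ^ (1 - 1 / p)
  have hc1 : 0 < c1 := by positivity
  have hc2 : 0 < c2 := by positivity
  set β := α * p / n with hβ
  have hβ0 : 0 < β := by positivity
  have hβ1 : β < 1 := (div_lt_one hN).2 hαp
  set K : ℝ := (n - α) * ((α⁻¹ + (n / p - α)⁻¹) * (c1 ^ (1 - β) * c2 ^ β)) with hK
  have hK0 : 0 < K := by positivity
  refine ⟨ENNReal.ofReal K, ENNReal.ofReal_ne_top, fun F hF hFp x => ?_⟩
  rw [rieszPotential_eq_lintegral_ball μ hαn hF, ← hn_def]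
  set M := dyadicMaximal μ F x with hM
  set N := (∫⁻ y, F y ^ p ∂μ) ^ (1 / p) with hNd
  have b1 : ∀ t > 0, ∫⁻ y in ball x t, F y ∂μ ≤ M * ENNReal.ofReal ((2 * t) ^ n * v) := by
    intro t ht
    rw [← hball (2 * t) (by positivity) 0]
    exact setLIntegral_ball_le_dyadicMaximal μ F x ht
  have b2 : ∀ t > 0, ∫⁻ y in ball x t, F y ∂μ ≤
      N * ENNReal.ofReal ((t ^ n * v) ^ (1 - 1 / p)) := by
    intro t ht
    rw [← ENNReal.ofReal_rpow_of_pos (by positivity), ← hball t ht x]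
    exact setLIntegral_le_rpow_mul_meas_rpow μ hF hp.le _
  -- if either bound vanishes, so does the potential
  have hzero : M = 0 ∨ N = 0 → ∫⁻ t in Ioi (0 : ℝ), ENNReal.ofReal (t ^ (α - n - 1)) *
      ∫⁻ y in ball x t, F y ∂μ = 0 := by
    intro h
    rw [setLIntegral_congr_fun (g := fun _ => 0) measurableSet_Ioi, lintegral_zero]
    intro t ht
    have : ∫⁻ y in ball x t, F y ∂μ = 0 := by
      rcases h with h | h
      · simpa [h] using b1 t ht
      · simpa [h] using b2 t ht
    simp only [this, mul_zero]
  rcases eq_or_ne M 0 with hM0 | hM0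
  · rw [hzero (Or.inl hM0), mul_zero]
    exact zero_le
  rcases eq_or_ne N 0 with hN0 | hN0
  · rw [hzero (Or.inr hN0), mul_zero]
    exact zero_le
  have hNt : N ≠ ⊤ := ENNReal.rpow_ne_top_of_nonneg (by positivity) hFp
  rcases eq_or_ne M ⊤ with hMt | hMt
  · rw [hMt, ENNReal.top_rpow_of_pos (by linarith), ENNReal.top_mul, ENNReal.mul_top]
    · exact le_top
    · simpa using hK0
    · simp [ENNReal.rpow_eq_zero_iff, hN0, hNt]
  have hMr : M = ENNReal.ofReal M.toReal := (ENNReal.ofReal_toReal hMt).symm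
  have hNr : N = ENNReal.ofReal N.toReal := (ENNReal.ofReal_toReal hNt).symm
  have hm0 : 0 < M.toReal := ENNReal.toReal_pos hM0 hMt
  have hn0 : 0 < N.toReal := ENNReal.toReal_pos hN0 hNt
  set m := M.toReal
  set w := N.toReal
  have hmain := lintegral_min_rpow_le (a := α) (b := n / p - α) hα hb
    (A := c1 * m) (B := c2 * w) (by positivity) (by positivity)
    (Φ := fun t => ENNReal.ofReal (t ^ (α - n - 1)) * ∫⁻ y in ball x t, F y ∂μ) ?_ ?_
  · refine (mul_le_mul_right hmain _).trans (le_of_eq ?_)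
    have e1 : α / (α + (n / p - α)) = β := by
      rw [add_sub_cancel, hβ]; field_simp
    have e2 : (n / p - α) / (α + (n / p - α)) = 1 - β := by
      rw [add_sub_cancel, hβ]; field_simp
    rw [e1, e2, hMr, hNr, ENNReal.ofReal_rpow_of_pos hm0, ENNReal.ofReal_rpow_of_pos hn0,
      ← ENNReal.ofReal_mul (by positivity), ← ENNReal.ofReal_mul (by positivity),
      ← ENNReal.ofReal_mul (by positivity), Real.mul_rpow hc1.le hm0.le,
      Real.mul_rpow hc2.le hn0.le]
    congr 1
    ring
  · intro t ht
    refine (mul_le_mul_right (b1 t ht) _).trans (le_of_eq ?_)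
    rw [hMr, ← ENNReal.ofReal_mul hm0.le, ← ENNReal.ofReal_mul (by positivity)]
    congr 1
    rw [Real.mul_rpow (by norm_num) ht.le, show α - 1 = (α - n - 1) + n by ring,
      Real.rpow_add ht]
    ring
  · intro t ht
    refine (mul_le_mul_right (b2 t ht) _).trans (le_of_eq ?_)
    rw [hNr, ← ENNReal.ofReal_mul hn0.le, ← ENNReal.ofReal_mul (by positivity)]
    congr 1
    rw [Real.mul_rpow (by positivity) hv0.le, ← Real.rpow_mul ht.le,
      show -(n / p - α) - 1 = (α - n - 1) + n * (1 - 1 / p) by ring, Real.rpow_add ht]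
    ring

/-- The Hardy–Littlewood–Sobolev theorem on fractional integration. -/
theorem rieszPotential_Lp_le {α p s : ℝ} (hα : 0 < α) (hαn : α < finrank ℝ E)
    (hp : 1 < p) (hpα : p < finrank ℝ E / α) (hs : 1 / s = 1 / p - α / finrank ℝ E) :
    ∃ C : ℝ≥0∞, C ≠ ⊤ ∧ ∀ F : E → ℝ≥0∞, Measurable F →
      (∫⁻ x, rieszPotential μ α F x ^ s ∂μ) ^ (1 / s) ≤ C * (∫⁻ x, F x ^ p ∂μ) ^ (1 / p) := by
  have hN : (0 : ℝ) < finrank ℝ E := hα.trans hαn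
  have : Nontrivial E := finrank_pos_iff.1 (by exact_mod_cast hN)
  have hp0 : 0 < p := by linarith
  have hαp : α * p < finrank ℝ E := by rwa [lt_div_iff₀ hα, mul_comm] at hpα
  obtain ⟨C₁, hC₁, h₁⟩ := rieszPotential_le_dyadicMaximal μ hα hαn hp hpα
  obtain ⟨C₂, hC₂, h₂⟩ := lintegral_dyadicMaximal_rpow_le μ hp
  set n : ℝ := (finrank ℝ E : ℝ) with hn_def
  have hs' : 1 / s = (1 - α * p / n) / p := by rw [hs]; field_simp
  have hβ1 : 0 < 1 - α * p / n := by rw [sub_pos, div_lt_one hN]; exact hαp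
  have hs0 : 0 < s := by
    rw [← one_div_pos, hs']; positivity
  have hps : (1 - α * p / n) * s = p := by
    field_simp at hs' ⊢
    linarith
  -- adding `1` keeps the constant nonzero, so that the bound is `⊤` when the norm of `F` is
  refine ⟨C₁ * C₂ ^ (1 / s) + 1, ?_, fun F hF => ?_⟩
  · exact ENNReal.add_ne_top.2 ⟨ENNReal.mul_ne_top hC₁
      (ENNReal.rpow_ne_top_of_nonneg (by positivity) hC₂), ENNReal.one_ne_top⟩
  by_cases hFp : ∫⁻ x, F x ^ p ∂μ = ⊤
  · rw [hFp, ENNReal.top_rpow_of_pos (by positivity), ENNReal.mul_top (by simp)]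
    exact le_top
  set N := (∫⁻ y, F y ^ p ∂μ) ^ (1 / p) with hNd
  have hNp : N ^ p = ∫⁻ y, F y ^ p ∂μ := by
    rw [hNd, ← ENNReal.rpow_mul, one_div_mul_cancel hp0.ne', ENNReal.rpow_one]
  calc (∫⁻ x, rieszPotential μ α F x ^ s ∂μ) ^ (1 / s)
      ≤ (∫⁻ x, (C₁ * N ^ (α * p / n)) ^ s * dyadicMaximal μ F x ^ p ∂μ) ^ (1 / s) := by
        gcongr with x
        refine (ENNReal.rpow_le_rpow (h₁ F hF hFp x) hs0.le).trans (le_of_eq ?_)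
        rw [← hNd, mul_left_comm, mul_comm, ENNReal.mul_rpow_of_nonneg _ _ hs0.le,
          ← ENNReal.rpow_mul (dyadicMaximal μ F x), hps]
    _ ≤ ((C₁ * N ^ (α * p / n)) ^ s * (C₂ * N ^ p)) ^ (1 / s) := by
        rw [lintegral_const_mul _ ((measurable_dyadicMaximal hF).pow_const p), hNp]
        gcongr
        exact h₂ F hF
    _ = C₁ * C₂ ^ (1 / s) * N := by
        rw [ENNReal.mul_rpow_of_nonneg (_ ^ s) _ (by positivity), ENNReal.mul_rpow_of_nonneg C₂ _
          (by positivity), ← ENNReal.rpow_mul (C₁ * _), mul_one_div_cancel hs0.ne',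
          ENNReal.rpow_one, ← ENNReal.rpow_mul N p, show p * (1 / s) = 1 - α * p / n by rw [hs']; field_simp]
        calc _ = C₁ * C₂ ^ (1 / s) * (N ^ (α * p / n) * N ^ (1 - α * p / n)) := by ring
          _ = _ := by
            rw [← ENNReal.rpow_add_of_nonneg _ _ (by positivity) hβ1.le, add_sub_cancel,
              ENNReal.rpow_one]
    _ ≤ _ := by
        gcongr
        exact le_self_add

/-! ### The bilinear potential over segments -/

/-- The nonnegative scalar analogue of `tensorJ`, with the segment parameter `θ` restricted to a set
`S`. -/
noncomputable def segmentPotential (α : ℝ) (S : Set ℝ) (F G : E → ℝ≥0∞) (x : E) : ℝ≥0∞ :=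
  ∫⁻ θ in S, ∫⁻ y, F (x + (θ - 1) • y) * G (x + θ • y) * ‖y‖ₑ ^ (α - finrank ℝ E) ∂μ

theorem segmentPotential_eq_lintegral_prod (α : ℝ) (S : Set ℝ) {F G : E → ℝ≥0∞}
    (hF : Measurable F) (hG : Measurable G) (x : E) :
    segmentPotential μ α S F G x = ∫⁻ z, F (x + (z.1 - 1) • z.2) * G (x + z.1 • z.2) *
      ‖z.2‖ₑ ^ (α - finrank ℝ E) ∂((volume.restrict S).prod μ) := by
  rw [lintegral_prod _ (by fun_prop)]
  rfl

theorem measurable_segmentPotential (α : ℝ) (S : Set ℝ) {F G : E → ℝ≥0∞}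
    (hF : Measurable F) (hG : Measurable G) : Measurable (segmentPotential μ α S F G) := by
  have h : segmentPotential μ α S F G = fun x => ∫⁻ z, F (x + (z.1 - 1) • z.2) * G (x + z.1 • z.2) *
      ‖z.2‖ₑ ^ (α - finrank ℝ E) ∂((volume.restrict S).prod μ) :=
    funext fun x => segmentPotential_eq_lintegral_prod μ α S hF hG x
  rw [h]
  exact Measurable.lintegral_prod_right' (f := fun w : E × (ℝ × E) =>
    F (w.1 + (w.2.1 - 1) • w.2.2) * G (w.1 + w.2.1 • w.2.2) * ‖w.2.2‖ₑ ^ (α - finrank ℝ E))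
    (by fun_prop)

/-- A dilation by a factor in `[1/2, 1]` changes the Riesz potential by at most a constant. -/
theorem lintegral_comp_smul_le_rieszPotential {α : ℝ} (hαn : α < finrank ℝ E) {F : E → ℝ≥0∞}
    (hF : Measurable F) (x : E) {c : ℝ} (hc : 1 / 2 ≤ c) (hc1 : c ≤ 1) :
    ∫⁻ y, F (x - c • y) * ‖y‖ₑ ^ (α - finrank ℝ E) ∂μ ≤
      2 ^ finrank ℝ E * rieszPotential μ α F x := by
  have hc0 : 0 < c := by linarith
  calc ∫⁻ y, F (x - c • y) * ‖y‖ₑ ^ (α - finrank ℝ E) ∂μ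
      ≤ ∫⁻ y, F (x - c • y) * ‖c • y‖ₑ ^ (α - finrank ℝ E) ∂μ := by
        refine lintegral_mono fun y => mul_le_mul_right ?_ _
        rw [← neg_sub, ENNReal.rpow_neg, ENNReal.rpow_neg, ENNReal.inv_le_inv, enorm_smul]
        refine ENNReal.rpow_le_rpow ?_ (by linarith)
        refine mul_le_of_le_one_left' ?_
        rw [Real.enorm_of_nonneg hc0.le]
        exact ENNReal.ofReal_le_one.2 hc1
    _ = ∫⁻ z, F (x - z) * ‖z‖ₑ ^ (α - finrank ℝ E) ∂(μ.map (c • ·)) := by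
        rw [lintegral_map (by fun_prop) (by fun_prop)]
    _ = ENNReal.ofReal |(c ^ finrank ℝ E)⁻¹| * rieszPotential μ α F x := by
        rw [Measure.map_addHaar_smul μ hc0.ne', lintegral_smul_measure]
        rfl
    _ ≤ _ := by
        gcongr
        rw [abs_of_pos (by positivity), ← inv_pow, ENNReal.ofReal_pow (by positivity)]
        gcongr
        rw [← ENNReal.ofReal_ofNat]
        refine ENNReal.ofReal_le_ofReal ?_
        rw [inv_le_comm₀ hc0 (by norm_num)]
        linarith

theorem volume_Ioc_zero_half_le_one : volume (Ioc (0 : ℝ) (1 / 2)) ≤ 1 := by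
  rw [Real.volume_Ioc]
  exact ENNReal.ofReal_le_one.2 (by norm_num)

/-- Hölder's inequality in `(θ, y)` for fixed `x`, keeping a power of `F` in both factors. For
`θ ≤ 1/2` the point `x + (θ - 1) y` moves with speed at least `1/2` in `y`, which makes the second
factor a Riesz potential of `F`. -/
theorem segmentPotential_half_le {α : ℝ} (hαn : α < finrank ℝ E) {F G : E → ℝ≥0∞}
    (hF : Measurable F) (hG : Measurable G) {t₁ t₂ : ℝ} (ht₁ : 0 < t₁) (ht₂ : 0 ≤ t₂)
    (ht : t₁ + t₂ = 1) (x : E) :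
    segmentPotential μ α (Ioc 0 (1 / 2)) F G x ≤
      segmentPotential μ α (Ioc 0 (1 / 2)) F (fun y => G y ^ (1 / t₁)) x ^ t₁ *
        (2 ^ finrank ℝ E * rieszPotential μ α F x) ^ t₂ := by
  have hsplit : ∀ a b : ℝ≥0∞, a * b = (a * b ^ (1 / t₁)) ^ t₁ * a ^ t₂ := by
    intro a b
    rw [ENNReal.mul_rpow_of_nonneg _ _ ht₁.le, ← ENNReal.rpow_mul, one_div_mul_cancel ht₁.ne',
      ENNReal.rpow_one, mul_right_comm, ← ENNReal.rpow_add_of_nonneg _ _ ht₁.le ht₂, ht,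
      ENNReal.rpow_one]
  rw [segmentPotential_eq_lintegral_prod μ α _ hF hG,
    segmentPotential_eq_lintegral_prod μ α _ hF (hG.pow_const _)]
  set ν := (volume.restrict (Ioc (0 : ℝ) (1 / 2))).prod μ
  calc ∫⁻ z, F (x + (z.1 - 1) • z.2) * G (x + z.1 • z.2) * ‖z.2‖ₑ ^ (α - finrank ℝ E) ∂ν
      = ∫⁻ z, (F (x + (z.1 - 1) • z.2) * G (x + z.1 • z.2) ^ (1 / t₁) *
          ‖z.2‖ₑ ^ (α - finrank ℝ E)) ^ t₁ *
          (F (x + (z.1 - 1) • z.2) * ‖z.2‖ₑ ^ (α - finrank ℝ E)) ^ t₂ ∂ν := by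
        refine lintegral_congr fun z => ?_
        rw [mul_right_comm, hsplit]
        congr 2
        ring
    _ ≤ _ := ENNReal.lintegral_mul_norm_pow_le (by fun_prop) (by fun_prop) ht₁.le ht₂ ht
    _ ≤ _ := by
        refine mul_le_mul_right (ENNReal.rpow_le_rpow ?_ ht₂) _
        rw [lintegral_prod _ (by fun_prop)]
        calc _ ≤ ∫⁻ _θ in Ioc (0 : ℝ) (1 / 2), 2 ^ finrank ℝ E * rieszPotential μ α F x := by
              refine setLIntegral_mono' measurableSet_Ioc fun θ hθ => ?_
              have := lintegral_comp_smul_le_rieszPotential μ hαn hF x (c := 1 - θ)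
                (by linarith [hθ.2]) (by linarith [hθ.1])
              refine le_trans (le_of_eq (lintegral_congr fun y => ?_)) this
              congr 2
              module
          _ ≤ _ := by
              rw [setLIntegral_const]
              exact mul_le_of_le_one_right' volume_Ioc_zero_half_le_one

/-- For every fixed `θ` the `x`-integral equals `∫ G · I_α F`, by translation invariance. -/
theorem lintegral_segmentPotential_half_le (α : ℝ) {F G : E → ℝ≥0∞}
    (hF : Measurable F) (hG : Measurable G) :
    ∫⁻ x, segmentPotential μ α (Ioc 0 (1 / 2)) F G x ∂μ ≤
      ∫⁻ x, G x * rieszPotential μ α F x ∂μ := by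
  have hθ : ∀ θ : ℝ, ∫⁻ x, ∫⁻ y, F (x + (θ - 1) • y) * G (x + θ • y) *
      ‖y‖ₑ ^ (α - finrank ℝ E) ∂μ ∂μ = ∫⁻ x, G x * rieszPotential μ α F x ∂μ := by
    intro θ
    rw [lintegral_lintegral_swap (by unfold Function.uncurry; fun_prop)]
    have h1 : ∀ y, ∫⁻ x, F (x + (θ - 1) • y) * G (x + θ • y) * ‖y‖ₑ ^ (α - finrank ℝ E) ∂μ =
        ∫⁻ x, G x * (F (x - y) * ‖y‖ₑ ^ (α - finrank ℝ E)) ∂μ := by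
      intro y
      rw [← lintegral_add_right_eq_self (μ := μ)
        (fun x => G x * (F (x - y) * ‖y‖ₑ ^ (α - finrank ℝ E))) (θ • y)]
      refine lintegral_congr fun x => ?_
      rw [show x + θ • y - y = x + (θ - 1) • y by module]
      ring
    simp only [h1]
    rw [lintegral_lintegral_swap (by unfold Function.uncurry; fun_prop)]
    refine lintegral_congr fun x => ?_
    rw [lintegral_const_mul _ (by fun_prop)]
    rfl
  unfold segmentPotential
  rw [lintegral_lintegral_swap]
  · simp only [hθ]
    rw [setLIntegral_const]
    exact mul_le_of_le_one_right' volume_Ioc_zero_half_le_one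
  · refine Measurable.aemeasurable ?_
    exact Measurable.lintegral_prod_right' (f := fun w : (E × ℝ) × E =>
      F (w.1.1 + (w.1.2 - 1) • w.2) * G (w.1.1 + w.1.2 • w.2) * ‖w.2‖ₑ ^ (α - finrank ℝ E))
      (by fun_prop)

/-- The bilinear estimate for `θ ≤ 1/2`. The exponents are `1/p`, `b = 1/q` and `c = 1 - 1/r`, and
`b + c < 1` is equivalent to `p < n / α`; the two weights in Hölder's inequality are proportional to
`b` and `c`, so that no condition relating `1/p + 1/q` to `1` is needed. -/
theorem segmentPotential_half_Lp_le {α p q r : ℝ} (hα : 0 < α) (hαn : α < finrank ℝ E)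
    (hp : 1 < p) (hpα : p < finrank ℝ E / α) (hq : 0 < q) (hr : 1 ≤ r)
    (hpqr : 1 / p + 1 / q = 1 / r + α / finrank ℝ E) :
    ∃ C : ℝ≥0∞, C ≠ ⊤ ∧ ∀ F G : E → ℝ≥0∞, Measurable F → Measurable G →
      (∫⁻ x, segmentPotential μ α (Ioc 0 (1 / 2)) F G x ^ r ∂μ) ^ (1 / r) ≤
        C * (∫⁻ x, F x ^ p ∂μ) ^ (1 / p) * (∫⁻ x, G x ^ q ∂μ) ^ (1 / q) := by
  have hN : (0 : ℝ) < finrank ℝ E := hα.trans hαn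
  have hp0 : 0 < p := by linarith
  have hr0 : 0 < r := by linarith
  have hαp : α / finrank ℝ E < 1 / p := by
    rw [lt_div_iff₀ hα] at hpα
    rw [div_lt_div_iff₀ hN hp0]
    linarith
  set b : ℝ := 1 / q with hb
  set c : ℝ := 1 - 1 / r with hc
  have hb0 : 0 < b := by positivity
  have hc0 : 0 ≤ c := sub_nonneg.2 ((div_le_one hr0).2 hr)
  have hbc : 0 < b + c := by linarith
  have hs1 : 1 - (b + c) = 1 / p - α / finrank ℝ E := by rw [hc]; linarith
  have hbc1 : 0 < 1 - (b + c) := by rw [hs1]; linarith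
  set s : ℝ := 1 / (1 - (b + c)) with hs
  have hs0 : 0 < s := by positivity
  have hs' : 1 / s = 1 - (b + c) := by rw [hs, one_div_one_div]
  set t₁ : ℝ := b / (b + c) with ht₁
  set t₂ : ℝ := c / (b + c) with ht₂
  have ht₁0 : 0 < t₁ := by positivity
  have ht₂0 : 0 ≤ t₂ := by positivity
  have ht : t₁ + t₂ = 1 := by rw [ht₁, ht₂]; field_simp
  obtain ⟨C, hC, hI⟩ := rieszPotential_Lp_le μ hα hαn hp hpα (hs'.trans hs1)
  refine ⟨(2 ^ finrank ℝ E) ^ t₂ * C, ENNReal.mul_ne_top (ENNReal.rpow_ne_top_of_nonneg ht₂0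
    (ENNReal.pow_ne_top (by norm_num))) hC, fun F G hF hG => ?_⟩
  set A := segmentPotential μ α (Ioc 0 (1 / 2)) F (fun y => G y ^ (1 / t₁))
  set I := rieszPotential μ α F
  have hA_meas : Measurable A := measurable_segmentPotential μ α _ hF (hG.pow_const _)
  have hI_meas : Measurable I := measurable_rieszPotential μ α hF
  set Is := (∫⁻ x, I x ^ s ∂μ) ^ (1 / s) with hIs
  have hAint : ∫⁻ x, A x ∂μ ≤ (∫⁻ x, G x ^ q ∂μ) ^ (b + c) * Is := by
    calc ∫⁻ x, A x ∂μ ≤ ∫⁻ x, G x ^ (1 / t₁) * I x ∂μ :=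
          lintegral_segmentPotential_half_le μ α hF (hG.pow_const _)
      _ = ∫⁻ x, (G x ^ q) ^ (b + c) * (I x ^ s) ^ (1 / s) ∂μ := by
          refine lintegral_congr fun x => ?_
          rw [← ENNReal.rpow_mul, ← ENNReal.rpow_mul, mul_one_div_cancel hs0.ne', ENNReal.rpow_one]
          congr 2
          rw [ht₁, one_div_div, hb]
          field_simp
      _ ≤ _ := ENNReal.lintegral_mul_norm_pow_le (by fun_prop) (by fun_prop) hbc.le (by positivity)
          (by rw [hs']; ring)
  have hexp : t₁ * r + t₂ * r * (1 / s) = 1 := by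
    have h2 : t₂ * (b + c) = c := by rw [ht₂]; field_simp
    calc t₁ * r + t₂ * r * (1 / s) = r * (t₁ + t₂ - t₂ * (b + c)) := by rw [hs']; ring
      _ = r * (1 / r) := by rw [ht, h2, hc]; ring
      _ = 1 := mul_one_div_cancel hr0.ne'
  have hpow : ∫⁻ x, segmentPotential μ α (Ioc 0 (1 / 2)) F G x ^ r ∂μ ≤
      (∫⁻ x, A x ∂μ) ^ (t₁ * r) *
        (∫⁻ x, (2 ^ finrank ℝ E * I x) ^ s ∂μ) ^ (t₂ * r * (1 / s)) := by
    calc _ ≤ ∫⁻ x, A x ^ (t₁ * r) * ((2 ^ finrank ℝ E * I x) ^ s) ^ (t₂ * r * (1 / s)) ∂μ := by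
          refine lintegral_mono fun x => ?_
          refine (ENNReal.rpow_le_rpow (segmentPotential_half_le μ hαn hF hG ht₁0 ht₂0 ht x)
            hr0.le).trans (le_of_eq ?_)
          rw [ENNReal.mul_rpow_of_nonneg _ _ hr0.le, ← ENNReal.rpow_mul, ← ENNReal.rpow_mul,
            ← ENNReal.rpow_mul, show s * (t₂ * r * (1 / s)) = t₂ * r by field_simp]
      _ ≤ _ := ENNReal.lintegral_mul_norm_pow_le (by fun_prop) (by fun_prop) (by positivity)
          (by positivity) hexp
  have hIs2 : (∫⁻ x, (2 ^ finrank ℝ E * I x) ^ s ∂μ) ^ (1 / s) = 2 ^ finrank ℝ E * Is := by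
    simp only [ENNReal.mul_rpow_of_nonneg _ _ hs0.le]
    rw [lintegral_const_mul _ (by fun_prop), ENNReal.mul_rpow_of_nonneg _ _ (by positivity),
      ← ENNReal.rpow_mul, mul_one_div_cancel hs0.ne', ENNReal.rpow_one]
  calc _ ≤ ((∫⁻ x, A x ∂μ) ^ (t₁ * r) *
        (∫⁻ x, (2 ^ finrank ℝ E * I x) ^ s ∂μ) ^ (t₂ * r * (1 / s))) ^ (1 / r) :=
        ENNReal.rpow_le_rpow hpow (by positivity)
    _ = (∫⁻ x, A x ∂μ) ^ t₁ * (2 ^ finrank ℝ E * Is) ^ t₂ := by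
        rw [ENNReal.mul_rpow_of_nonneg _ _ (by positivity), ← hIs2, ← ENNReal.rpow_mul,
          ← ENNReal.rpow_mul, ← ENNReal.rpow_mul]
        congr 2 <;> field_simp
    _ ≤ ((∫⁻ x, G x ^ q ∂μ) ^ (b + c) * Is) ^ t₁ * (2 ^ finrank ℝ E * Is) ^ t₂ := by
        gcongr
    _ = (2 ^ finrank ℝ E) ^ t₂ * (Is ^ t₁ * Is ^ t₂) * (∫⁻ x, G x ^ q ∂μ) ^ b := by
        rw [ENNReal.mul_rpow_of_nonneg _ _ ht₁0.le, ENNReal.mul_rpow_of_nonneg _ _ ht₂0,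
          ← ENNReal.rpow_mul, show (b + c) * t₁ = b by rw [ht₁]; field_simp]
        ring
    _ = (2 ^ finrank ℝ E) ^ t₂ * Is * (∫⁻ x, G x ^ q ∂μ) ^ b := by
        rw [← ENNReal.rpow_add_of_nonneg _ _ ht₁0.le ht₂0, ht, ENNReal.rpow_one]
    _ ≤ _ := by
        rw [mul_assoc (_ ^ t₂) C]
        gcongr
        exact hI F hF

/-- The reflection `(θ, y) ↦ (1 - θ, -y)` exchanges the two arguments, so that the range
`θ ≥ 1/2` reduces to `θ ≤ 1/2`. -/
theorem segmentPotential_Ioc_zero_one (α : ℝ) {F G : E → ℝ≥0∞} (hF : Measurable F)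
    (hG : Measurable G) (x : E) :
    segmentPotential μ α (Ioc 0 1) F G x = segmentPotential μ α (Ioc 0 (1 / 2)) F G x +
      segmentPotential μ α (Ioc 0 (1 / 2)) G F x := by
  have hmeas : ∀ F G : E → ℝ≥0∞, Measurable F → Measurable G → Measurable fun θ : ℝ =>
      ∫⁻ y, F (x + (θ - 1) • y) * G (x + θ • y) * ‖y‖ₑ ^ (α - finrank ℝ E) ∂μ :=
    fun F G hF hG => Measurable.lintegral_prod_right' (f := fun z : ℝ × E =>
      F (x + (z.1 - 1) • z.2) * G (x + z.1 • z.2) * ‖z.2‖ₑ ^ (α - finrank ℝ E)) (by fun_prop)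
  unfold segmentPotential
  rw [← Ioc_union_Ioc_eq_Ioc (by norm_num : (0 : ℝ) ≤ 1 / 2) (by norm_num : (1 / 2 : ℝ) ≤ 1),
    lintegral_union measurableSet_Ioc (Ioc_disjoint_Ioc_of_le le_rfl)]
  congr 1
  have h := (Measure.measurePreserving_sub_left (volume : Measure ℝ) 1).setLIntegral_comp_preimage
    (measurableSet_Ioc (a := (1 / 2 : ℝ)) (b := 1)) (hmeas F G hF hG)
  rw [← h, preimage_const_sub_Ioc, show (1 : ℝ) - 1 / 2 = 1 / 2 by norm_num, sub_self,
    setLIntegral_congr Ico_ae_eq_Ioc]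
  refine lintegral_congr fun θ => ?_
  rw [← lintegral_neg_eq_self]
  refine lintegral_congr fun y => ?_
  rw [enorm_neg, show x + (1 - θ - 1) • -y = x + θ • y by module,
    show x + (1 - θ) • -y = x + (θ - 1) • y by module, mul_comm (F _)]

theorem segmentPotential_Lp_le {α p q r : ℝ} (hα : 0 < α) (hαn : α < finrank ℝ E)
    (hp : 1 < p) (hpα : p < finrank ℝ E / α) (hq : 1 < q) (hqα : q < finrank ℝ E / α) (hr : 1 ≤ r)
    (hpqr : 1 / p + 1 / q = 1 / r + α / finrank ℝ E) :
    ∃ C : ℝ≥0∞, C ≠ ⊤ ∧ ∀ F G : E → ℝ≥0∞, Measurable F → Measurable G →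
      (∫⁻ x, segmentPotential μ α (Ioc 0 1) F G x ^ r ∂μ) ^ (1 / r) ≤
        C * (∫⁻ x, F x ^ p ∂μ) ^ (1 / p) * (∫⁻ x, G x ^ q ∂μ) ^ (1 / q) := by
  obtain ⟨C₁, hC₁, h₁⟩ := segmentPotential_half_Lp_le μ hα hαn hp hpα (by linarith) hr hpqr
  obtain ⟨C₂, hC₂, h₂⟩ := segmentPotential_half_Lp_le μ hα hαn hq hqα (by linarith : 0 < p) hr
    (by rw [← hpqr, add_comm])
  refine ⟨C₁ + C₂, ENNReal.add_ne_top.2 ⟨hC₁, hC₂⟩, fun F G hF hG => ?_⟩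
  simp only [segmentPotential_Ioc_zero_one μ α hF hG]
  refine (ENNReal.lintegral_Lp_add_le (measurable_segmentPotential μ α _ hF hG).aemeasurable
    (measurable_segmentPotential μ α _ hG hF).aemeasurable hr).trans ?_
  refine (add_le_add (h₁ F G hF hG) (h₂ G F hG hF)).trans (le_of_eq ?_)
  ring

end Haar

/-! ### `L^p` norms -/

theorem memLp_of_memLp_one_of_memLp {X : Type*} [MeasurableSpace X] {μ : Measure X} {f : X → ℝ}
    {p γ : ℝ} (hp : 1 ≤ p) (hpγ : p ≤ γ) (h₁ : MemLp f 1 μ) (hγ : MemLp f (ENNReal.ofReal γ) μ) :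
    MemLp f (ENNReal.ofReal p) μ := by
  have hp0 : 0 < p := by linarith
  have hγ0 : 0 < γ := by linarith
  refine ⟨h₁.1, ?_⟩
  have i₁ := lintegral_rpow_enorm_lt_top_of_eLpNorm_lt_top one_ne_zero ENNReal.one_ne_top h₁.2
  have i₂ := lintegral_rpow_enorm_lt_top_of_eLpNorm_lt_top (by simpa using hγ0)
    ENNReal.ofReal_ne_top hγ.2
  rw [eLpNorm_lt_top_iff_lintegral_rpow_enorm_lt_top (by simpa using hp0) ENNReal.ofReal_ne_top]
  simp only [ENNReal.toReal_one, ENNReal.toReal_ofReal hγ0.le, ENNReal.toReal_ofReal hp0.le]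
    at i₁ i₂ ⊢
  calc ∫⁻ x, ‖f x‖ₑ ^ p ∂μ ≤ ∫⁻ x, (‖f x‖ₑ ^ (1 : ℝ) + ‖f x‖ₑ ^ γ) ∂μ := by
        refine lintegral_mono fun x => ?_
        -- the power `p` is dominated by the power `1` where `|f| ≤ 1` and by the power `γ` elsewhere
        rcases le_total ‖f x‖ₑ 1 with h | h
        · exact (ENNReal.rpow_le_rpow_of_exponent_ge h hp).trans le_self_add
        · exact (ENNReal.rpow_le_rpow_of_exponent_le h hpγ).trans le_add_self
    _ = _ := lintegral_add_left' (h₁.1.enorm.pow_const _) _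
    _ < ⊤ := ENNReal.add_lt_top.2 ⟨i₁, i₂⟩

theorem eLpNorm_ofReal_eq {X ε : Type*} [MeasurableSpace X] [TopologicalSpace ε]
    [ContinuousENorm ε] (μ : Measure X) (f : X → ε) {p : ℝ} (hp : 0 < p) :
    eLpNorm f (ENNReal.ofReal p) μ = (∫⁻ x, ‖f x‖ₑ ^ p ∂μ) ^ (1 / p) := by
  rw [eLpNorm_eq_lintegral_rpow_enorm_toReal (by simpa using hp) ENNReal.ofReal_ne_top,
    ENNReal.toReal_ofReal hp.le]

/-! ### The tensor-valued operators -/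

/-- A property that holds almost everywhere holds at `x + φ θ • y` for almost every `(θ, y)`. -/
theorem ae_prod_of_ae_add_smul {E : Type*} [NormedAddCommGroup E] [NormedSpace ℝ E]
    [FiniteDimensional ℝ E] [MeasurableSpace E] [BorelSpace E] {μ : Measure E} [μ.IsAddHaarMeasure]
    {ν : Measure ℝ} [SFinite ν] {φ : ℝ → ℝ} (hφ : Measurable φ) (hφ0 : ∀ᵐ θ ∂ν, φ θ ≠ 0)
    {P : E → Prop} (hP : ∀ᵐ y ∂μ, P y) (x : E) :
    ∀ᵐ z ∂ν.prod μ, P (x + φ z.1 • z.2) := by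
  obtain ⟨N, hPN, hN, hN0⟩ := exists_measurable_superset_of_null (ae_iff.1 hP)
  have hNms : MeasurableSet {z : ℝ × E | x + φ z.1 • z.2 ∈ N} :=
    (by fun_prop : Measurable fun z : ℝ × E => x + φ z.1 • z.2) hN
  have h : ∀ᵐ z ∂ν.prod μ, z ∉ {z : ℝ × E | x + φ z.1 • z.2 ∈ N} := by
    refine measure_eq_zero_iff_ae_notMem.1 ((Measure.measure_prod_null hNms).2 ?_)
    filter_upwards [hφ0] with θ hθ
    have hq : Measure.QuasiMeasurePreserving (fun y : E => x + φ θ • y) μ μ :=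
      (quasiMeasurePreserving_add_left μ x).comp (Measure.quasiMeasurePreserving_smul μ hθ)
    exact hq.preimage_null hN0
  filter_upwards [h] with z hz
  by_contra hc
  exact hz (hPN hc)

theorem continuous_rankOne_self {E : Type*} [NormedAddCommGroup E] [InnerProductSpace ℝ E] :
    Continuous fun y : E => InnerProductSpace.rankOne ℝ y y :=
  (InnerProductSpace.rankOne ℝ (E := E) (F := E)).continuous₂.comp
    (continuous_id.prodMk continuous_id)

section Tensor

variable {d : ℕ} {f g f' g' : EuclideanSpace ℝ (Fin d) → ℝ}

theorem enorm_tensorIntegrand_le (α : ℝ) (f g : EuclideanSpace ℝ (Fin d) → ℝ)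
    (x : EuclideanSpace ℝ (Fin d)) (z : ℝ × EuclideanSpace ℝ (Fin d)) :
    ‖tensorIntegrand α f g x z‖ₑ ≤ ‖f (x + (z.1 - 1) • z.2)‖ₑ * ‖g (x + z.1 • z.2)‖ₑ *
      ‖z.2‖ₑ ^ (α - finrank ℝ (EuclideanSpace ℝ (Fin d))) := by
  rw [finrank_euclideanSpace_fin, tensorIntegrand, enorm_smul, enorm_mul, enorm_mul,
    InnerProductSpace.enorm_rankOne, mul_assoc]
  gcongr
  -- at `y = 0` the left side vanishes because `y ⊗ y` does, whatever the value of the power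
  rcases eq_or_ne z.2 0 with h | h
  · simp [h]
  have hpos : 0 < ‖z.2‖ := norm_pos_iff.2 h
  rw [Real.enorm_of_nonneg (by positivity), ← ofReal_norm, ENNReal.ofReal_rpow_of_pos hpos,
    ← ENNReal.ofReal_mul (by positivity), ← ENNReal.ofReal_mul (by positivity)]
  refine ENNReal.ofReal_le_ofReal (le_of_eq ?_)
  rw [Real.rpow_sub hpos (α - d), Real.rpow_two]
  field_simp

theorem enorm_tensorJ_le (α : ℝ) (f g : EuclideanSpace ℝ (Fin d) → ℝ)
    (x : EuclideanSpace ℝ (Fin d)) :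
    ‖tensorJ α f g x‖ₑ ≤
      segmentPotential volume α (Ioc 0 1) (fun y => ‖f y‖ₑ) (fun y => ‖g y‖ₑ) x := by
  rw [tensorJ, intervalIntegral.integral_of_le zero_le_one]
  refine (enorm_integral_le_lintegral_enorm _).trans (lintegral_mono fun θ => ?_)
  exact (enorm_integral_le_lintegral_enorm _).trans
    (lintegral_mono fun y => enorm_tensorIntegrand_le α f g x (θ, y))

theorem stronglyMeasurable_tensorIntegrand (α : ℝ) (hf : Measurable f) (hg : Measurable g) :
    StronglyMeasurable fun w : EuclideanSpace ℝ (Fin d) × (ℝ × EuclideanSpace ℝ (Fin d)) =>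
      tensorIntegrand α f g w.1 w.2 := by
  have h₁ : Measurable fun w : EuclideanSpace ℝ (Fin d) × (ℝ × EuclideanSpace ℝ (Fin d)) =>
      f (w.1 + (w.2.1 - 1) • w.2.2) * g (w.1 + w.2.1 • w.2.2) * ‖w.2.2‖ ^ (α - (d : ℝ) - 2) := by
    fun_prop
  have h₂ := (continuous_rankOne_self (E := EuclideanSpace ℝ (Fin d))).stronglyMeasurable
  unfold tensorIntegrand
  exact h₁.stronglyMeasurable.smul (h₂.comp_measurable (measurable_snd.comp measurable_snd))

theorem stronglyMeasurable_tensorJ (α : ℝ) (hf : Measurable f) (hg : Measurable g) :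
    StronglyMeasurable (tensorJ α f g) := by
  have h := stronglyMeasurable_tensorIntegrand α hf hg
  have h1 : StronglyMeasurable fun w : EuclideanSpace ℝ (Fin d) × ℝ =>
      ∫ y : EuclideanSpace ℝ (Fin d), tensorIntegrand α f g w.1 (w.2, y) :=
    StronglyMeasurable.integral_prod_right' (f := fun v : (EuclideanSpace ℝ (Fin d) × ℝ) ×
      EuclideanSpace ℝ (Fin d) => tensorIntegrand α f g v.1.1 (v.1.2, v.2))
      (h.comp_measurable (g := fun v : (EuclideanSpace ℝ (Fin d) × ℝ) ×
        EuclideanSpace ℝ (Fin d) => (v.1.1, (v.1.2, v.2))) (by fun_prop))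
  have h2 := StronglyMeasurable.integral_prod_right' (ν := volume.restrict (Ioc (0 : ℝ) 1)) h1
  unfold tensorJ
  simpa only [intervalIntegral.integral_of_le zero_le_one] using h2

/-- The integrals depend only on the almost everywhere classes of `f` and `g`, at every point `x`. -/
theorem tensorIntegrand_congr_ae (α : ℝ) (hf : f =ᵐ[volume] f') (hg : g =ᵐ[volume] g')
    (x : EuclideanSpace ℝ (Fin d)) :
    tensorIntegrand α f g x =ᵐ[(volume.restrict (Ioc (0 : ℝ) 1)).prod volume]
      tensorIntegrand α f' g' x := by
  have hne : ∀ c : ℝ, ∀ᵐ θ ∂(volume.restrict (Ioc (0 : ℝ) 1)), θ - c ≠ 0 := fun c =>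
    ae_restrict_of_ae ((measure_eq_zero_iff_ae_notMem.1 (measure_singleton c)).mono
      fun θ hθ h => hθ (sub_eq_zero.1 h))
  have h1 := ae_prod_of_ae_add_smul (by fun_prop) (hne 1) hf x
  have h2 := ae_prod_of_ae_add_smul (by fun_prop) (hne 0) hg x
  filter_upwards [h1, h2] with z hz1 hz2
  rw [sub_zero] at hz2
  rw [tensorIntegrand, tensorIntegrand, hz1, hz2]

theorem tensorJ_congr_ae (α : ℝ) (hf : f =ᵐ[volume] f') (hg : g =ᵐ[volume] g') :
    tensorJ α f g = tensorJ α f' g' := by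
  ext1 x
  rw [tensorJ, tensorJ, intervalIntegral.integral_of_le zero_le_one,
    intervalIntegral.integral_of_le zero_le_one]
  refine integral_congr_ae ?_
  filter_upwards [Measure.ae_ae_of_ae_prod (tensorIntegrand_congr_ae α hf hg x)] with θ hθ
  exact integral_congr_ae hθ

theorem tensorConverges_congr_ae (α : ℝ) (hf : f =ᵐ[volume] f') (hg : g =ᵐ[volume] g')
    (x : EuclideanSpace ℝ (Fin d)) : TensorConverges α f g x ↔ TensorConverges α f' g' x :=
  integrable_congr (tensorIntegrand_congr_ae α hf hg x)

theorem tensorConverges_of_segmentPotential_ne_top (α : ℝ) (hf : Measurable f) (hg : Measurable g)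
    {x : EuclideanSpace ℝ (Fin d)}
    (hx : segmentPotential volume α (Ioc 0 1) (fun y => ‖f y‖ₑ) (fun y => ‖g y‖ₑ) x ≠ ⊤) :
    TensorConverges α f g x := by
  refine ⟨((stronglyMeasurable_tensorIntegrand α hf hg).comp_measurable
    measurable_prodMk_left).aestronglyMeasurable, ?_⟩
  rw [segmentPotential_eq_lintegral_prod volume α _ hf.enorm hg.enorm] at hx
  exact (lintegral_mono fun z => enorm_tensorIntegrand_le α f g x z).trans_lt hx.lt_top

theorem tensorJ_Lp_le {α p q r : ℝ} (hα : 0 < α) (hαd : α < d)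
    (hp : 1 < p) (hpα : p < d / α) (hq : 1 < q) (hqα : q < d / α) (hr : 1 ≤ r)
    (hpqr : 1 / p + 1 / q = 1 / r + α / d) :
    ∃ C : ℝ, 0 < C ∧ ∀ f g : EuclideanSpace ℝ (Fin d) → ℝ,
      MemLp f (ENNReal.ofReal p) volume → MemLp g (ENNReal.ofReal q) volume →
        (∀ᵐ x : EuclideanSpace ℝ (Fin d), TensorConverges α f g x) ∧
        MemLp (tensorJ α f g) (ENNReal.ofReal r) volume ∧
        eLpNorm (tensorJ α f g) (ENNReal.ofReal r) volume ≤
          ENNReal.ofReal C * eLpNorm f (ENNReal.ofReal p) volume *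
            eLpNorm g (ENNReal.ofReal q) volume := by
  have hd : (finrank ℝ (EuclideanSpace ℝ (Fin d)) : ℝ) = d := by rw [finrank_euclideanSpace_fin]
  have hr0 : 0 < r := by linarith
  obtain ⟨C, hC, hbound⟩ := segmentPotential_Lp_le
    (volume : Measure (EuclideanSpace ℝ (Fin d))) hα (by rwa [hd]) hp (by rwa [hd]) hq
    (by rwa [hd]) hr (by rwa [hd])
  refine ⟨C.toReal + 1, by positivity, fun f g hf hg => ?_⟩
  obtain ⟨f', hf'm, hff'⟩ := hf.1
  obtain ⟨g', hg'm, hgg'⟩ := hg.1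
  replace hf'm := hf'm.measurable
  replace hg'm := hg'm.measurable
  simp only [tensorConverges_congr_ae α hff' hgg', tensorJ_congr_ae α hff' hgg']
  set K := segmentPotential volume α (Ioc 0 1) (fun y => ‖f' y‖ₑ) (fun y => ‖g' y‖ₑ) with hK
  have hKm : Measurable K := measurable_segmentPotential volume α _ hf'm.enorm hg'm.enorm
  have hKle : (∫⁻ x, K x ^ r) ^ (1 / r) ≤ ENNReal.ofReal (C.toReal + 1) *
      eLpNorm f (ENNReal.ofReal p) volume * eLpNorm g (ENNReal.ofReal q) volume := by
    rw [eLpNorm_congr_ae hff', eLpNorm_congr_ae hgg', eLpNorm_ofReal_eq _ _ (by linarith),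
      eLpNorm_ofReal_eq _ _ (by linarith)]
    refine (hbound _ _ hf'm.enorm hg'm.enorm).trans ?_
    gcongr
    calc C = ENNReal.ofReal C.toReal := (ENNReal.ofReal_toReal hC).symm
      _ ≤ _ := ENNReal.ofReal_le_ofReal (by linarith)
  have hfin : ENNReal.ofReal (C.toReal + 1) * eLpNorm f (ENNReal.ofReal p) volume *
      eLpNorm g (ENNReal.ofReal q) volume < ⊤ :=
    ENNReal.mul_lt_top (ENNReal.mul_lt_top ENNReal.ofReal_lt_top hf.2) hg.2
  have hJ : eLpNorm (tensorJ α f' g') (ENNReal.ofReal r) volume ≤ ENNReal.ofReal (C.toReal + 1) *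
      eLpNorm f (ENNReal.ofReal p) volume * eLpNorm g (ENNReal.ofReal q) volume := by
    refine le_trans ?_ hKle
    rw [eLpNorm_ofReal_eq _ _ hr0]
    gcongr with x
    exact enorm_tensorJ_le α f' g' x
  refine ⟨?_, ⟨(stronglyMeasurable_tensorJ α hf'm hg'm).aestronglyMeasurable, hJ.trans_lt hfin⟩, hJ⟩
  have hKr : ∫⁻ x, K x ^ r ≠ ⊤ := by
    intro h
    rw [h, ENNReal.top_rpow_of_pos (by positivity)] at hKle
    exact (hKle.trans_lt hfin).ne rfl
  filter_upwards [ae_lt_top (hKm.pow_const r) hKr] with x hx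
  refine tensorConverges_of_segmentPotential_ne_top α hf'm hg'm fun h => ?_
  rw [← hK] at h
  rw [h, ENNReal.top_rpow_of_pos hr0] at hx
  exact hx.ne rfl

theorem norm_tensorS_le (α : ℝ) (ρ : EuclideanSpace ℝ (Fin d) → ℝ)
    (x : EuclideanSpace ℝ (Fin d)) : ‖tensorS α ρ x‖ ≤ ‖tensorJ α ρ ρ x‖ := by
  rw [show tensorS α ρ x = (1 / 2 : ℝ) • tensorJ α ρ ρ x from rfl, norm_smul]
  exact mul_le_of_le_one_left (norm_nonneg _) (by norm_num)

end Tensor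

theorem mainTheorem2 (d : ℕ) (α : ℝ) (hα : 0 < α) (hαd : α < (d : ℝ)) :
    (∀ p q r : ℝ, 1 < p → p < (d : ℝ) / α → 1 < q → q < (d : ℝ) / α → 1 ≤ r →
      1 / p + 1 / q = 1 / r + α / (d : ℝ) →
      ∃ C : ℝ, 0 < C ∧ ∀ f g : EuclideanSpace ℝ (Fin d) → ℝ,
        MemLp f (ENNReal.ofReal p) volume → MemLp g (ENNReal.ofReal q) volume →
          (∀ᵐ x : EuclideanSpace ℝ (Fin d), TensorConverges α f g x) ∧
          MemLp (tensorJ α f g) (ENNReal.ofReal r) volume ∧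
          eLpNorm (tensorJ α f g) (ENNReal.ofReal r) volume ≤
            ENNReal.ofReal C * eLpNorm f (ENNReal.ofReal p) volume *
              eLpNorm g (ENNReal.ofReal q) volume) ∧
    (∀ p r : ℝ, 1 ≤ r → p = 2 * (d : ℝ) * r / ((d : ℝ) + α * r) → 1 < p → p < (d : ℝ) / α →
      ∃ C : ℝ, 0 < C ∧
        (∀ ρ : EuclideanSpace ℝ (Fin d) → ℝ, MemLp ρ (ENNReal.ofReal p) volume →
          (∀ᵐ x : EuclideanSpace ℝ (Fin d), TensorConverges α ρ ρ x) ∧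
          MemLp (tensorS α ρ) (ENNReal.ofReal r) volume ∧
          eLpNorm (tensorS α ρ) (ENNReal.ofReal r) volume ≤
            ENNReal.ofReal C * eLpNorm ρ (ENNReal.ofReal p) volume ^ 2) ∧
        (∀ (γ : ℝ) (ρ : EuclideanSpace ℝ (Fin d) → ℝ), p ≤ γ →
          MemLp ρ 1 volume → MemLp ρ (ENNReal.ofReal γ) volume →
          MemLp ρ (ENNReal.ofReal p) volume ∧
          MemLp (tensorS α ρ) (ENNReal.ofReal r) volume ∧
          eLpNorm (tensorS α ρ) (ENNReal.ofReal r) volume ≤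
            ENNReal.ofReal C * eLpNorm ρ (ENNReal.ofReal p) volume ^ 2)) := by
  have hd : 0 < (d : ℝ) := hα.trans hαd
  refine ⟨fun p q r hp hpα hq hqα hr h => tensorJ_Lp_le hα hαd hp hpα hq hqα hr h,
    fun p r hr hpr hp hpα => ?_⟩
  have hr0 : 0 < r := by linarith
  obtain ⟨C, hC, h⟩ := tensorJ_Lp_le (r := r) hα hαd hp hpα hp hpα hr (by
    rw [hpr]
    field_simp
    ring)
  have hS : ∀ ρ : EuclideanSpace ℝ (Fin d) → ℝ, MemLp ρ (ENNReal.ofReal p) volume →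
      (∀ᵐ x : EuclideanSpace ℝ (Fin d), TensorConverges α ρ ρ x) ∧
      MemLp (tensorS α ρ) (ENNReal.ofReal r) volume ∧
      eLpNorm (tensorS α ρ) (ENNReal.ofReal r) volume ≤
        ENNReal.ofReal C * eLpNorm ρ (ENNReal.ofReal p) volume ^ 2 := by
    intro ρ hρ
    obtain ⟨h1, h2, h3⟩ := h ρ ρ hρ hρ
    have hle := norm_tensorS_le α ρ
    refine ⟨h1, h2.of_le (h2.1.const_smul (1 / 2 : ℝ)) (.of_forall hle), ?_⟩
    rw [pow_two, ← mul_assoc]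
    exact (eLpNorm_mono hle).trans h3
  refine ⟨C, hC, hS, fun γ ρ hγ h1 hργ => ?_⟩
  have hρ := memLp_of_memLp_one_of_memLp hp.le hγ h1 hργ
  exact ⟨hρ, (hS ρ hρ).2⟩
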